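/- Let $\sigma>0$ and $\rho>0$, and consider a two-way link between two users assisted by a reconfigurable surface with a single reflecting element ($L=1$) over reciprocal Rayleigh fading channels: the channel coefficients $h=\alpha e^{-i\varphi}$ and $g=\beta e^{-i\psi}$ ($\alpha,\beta\ge 0$) are independent circularly symmetric complex Gaussian random variables $\mathcal{CN}(0,\sigma^2)$ (real and imaginary parts independent, each $\mathcal N(0,\sigma^2/2)$). With the optimal phase $\phi^\star=\varphi+\psi$ at the element, the instantaneous SINR of a user is $\gamma=\rho\,|g\,e^{i\phi^\star}h|^2=\rho(\alpha\beta)^2$, where $\rho$ is the average SINR. Let $F_\gamma$ be the distribution function of $\gamma$ and let $\mathsf R=\mathsf E[\log_2(1+\gamma)]$ be the average spectral efficiency. Then $\mathsf R$ is finite, all integrals below converge absolutely, and the following hold. 1. For every $t>0$, $$1-F_\gamma(t)=\frac{2}{\sigma^2}\sqrt{\frac t\rho}\;K_1\!\left(\frac{2}{\sigma^2}\sqrt{\frac t\rho}\right),$$ where $K_\nu(x)=\int_0^\infty e^{-x\cosh u}\cosh(\nu u)\,du$ ($x>0$) is the modified Bessel function of the second kind. 2. $$\mathsf R=\frac1{\log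 2}\int_0^\infty\frac{1-F_\gamma(x)}{1+x}\,dx=\frac{1}{\log 2}\,\frac{2}{\sigma^2\sqrt\rho}\int_0^\infty\frac{\sqrt x}{1+x}\,K_1\!\left(\frac{2}{\sigma^2}\sqrt{\frac x\rho}\right)dx .$$ 3. $$\mathsf R=\frac{1}{\log(2)\,\sigma^2\sqrt\rho}\;G^{3,1}_{1,3}\!\left(\frac{1}{\sigma^4\rho}\;\middle|\;\begin{matrix}-\frac12\\-\frac12,-\frac12,\frac12\end{matrix}\right).$$ Here $G^{m,n}_{p,q}$ is the Meijer $G$ function, $$G^{m,n}_{p,q}\!\left(z\,\middle|\,\begin{matrix}a_1,\dots,a_p\\ b_1,\dots,b_q\end{matrix}\right)=\frac1{2\pi i}\int_{c-i\infty}^{c+i\infty}\frac{\prod_{j=1}^m\Gamma(b_j-s)\prod_{j=1}^n\Gamma(1-a_j+s)}{\prod_{j=m+1}^q\Gamma(1-b_j+s)\prod_{j=n+1}^p\Gamma(a_j-s)}\,z^s\,ds ,$$ where the line $\operatorname{Re}s=c$ has the poles of $\Gamma(b_j-s)$, $j\le m$, on its right and those of $\Gamma(1-a_j+s)$, $j\le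 n$, on its left. For the parameters in 3 such lines exist, and the integral converges absolutely and has the same value on every such line. -/

import Mathlib

open MeasureTheory ProbabilityTheory

noncomputable section

/-! ### Special functions -/

/-- The modified Bessel function of the second kind `K_ν(x)`, for real order and `x > 0`,
by `K_ν(x) = ∫₀^∞ exp(-x cosh t) cosh(ν t) dt`. -/
def besselK (ν x : ℝ) : ℝ :=
  ∫ t in Set.Ioi (0 : ℝ), Real.exp (-x * Real.cosh t) * Real.cosh (ν * t)

/-- The Mellin-Barnes integrand of the Meijer function `G^{m,n}_{p,q}(z | a; b)`:
`∏_{j ≤ m} Γ(b_j - s) ∏_{j ≤ n} Γ(1 - a_j + s) z^s`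
divided by `∏_{j > m} Γ(1 - b_j + s) ∏_{j > n} Γ(a_j - s)`.
(`Complex.Gamma` vanishes at its poles, so `Γ⁻¹` below is the entire function `1/Γ`.) -/
def meijerGIntegrand (m n : ℕ) {p q : ℕ} (a : Fin p → ℂ) (b : Fin q → ℂ) (z s : ℂ) : ℂ :=
  (∏ j : Fin q, if (j : ℕ) < m then Complex.Gamma (b j - s) else (Complex.Gamma (1 - b j + s))⁻¹) *
  (∏ j : Fin p, if (j : ℕ) < n then Complex.Gamma (1 - a j + s) else (Complex.Gamma (a j - s))⁻¹) *
  z ^ s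

/-- The vertical line `Re s = c` separates the poles `b_j, b_j + 1, …` (`j ≤ m`) of the
`Γ(b_j - s)`, which lie to its right, from the poles `a_j - 1, a_j - 2, …` (`j ≤ n`) of the
`Γ(1 - a_j + s)`, which lie to its left. -/
def SeparatesPoles (m n : ℕ) {p q : ℕ} (a : Fin p → ℂ) (b : Fin q → ℂ) (c : ℝ) : Prop :=
  (∀ j : Fin q, (j : ℕ) < m → c < (b j).re) ∧ (∀ j : Fin p, (j : ℕ) < n → (a j).re - 1 < c)

/-- `(1 / 2πi) ∫ ds` of the Mellin-Barnes integrand, upwards along the line `Re s = c`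
(with `s = c + i t`, `ds = i dt`). -/
def meijerGLineIntegral (m n : ℕ) {p q : ℕ} (a : Fin p → ℂ) (b : Fin q → ℂ) (z : ℂ) (c : ℝ) : ℂ :=
  (1 / (2 * (Real.pi : ℂ))) * ∫ t : ℝ, meijerGIntegrand m n a b z ((c : ℂ) + (t : ℂ) * Complex.I)

/-- The Mellin-Barnes integral converges absolutely on every vertical line that separates the
poles, there is such a line, and the integral has the value `w` on each of them. -/
def HasMeijerG (m n : ℕ) {p q : ℕ} (a : Fin p → ℂ) (b : Fin q → ℂ) (z w : ℂ) : Prop :=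
  (∃ c : ℝ, SeparatesPoles m n a b c) ∧
  ∀ c : ℝ, SeparatesPoles m n a b c →
    Integrable (fun t : ℝ => meijerGIntegrand m n a b z ((c : ℂ) + (t : ℂ) * Complex.I)) ∧
    meijerGLineIntegral m n a b z c = w

open Classical in
/-- The Meijer function `G^{m,n}_{p,q}(z | a; b)` for parameters whose two families of poles are
separated by a vertical line: the Mellin-Barnes integral along such a line
(junk value `0` if there is none). -/
def meijerG (m n : ℕ) {p q : ℕ} (a : Fin p → ℂ) (b : Fin q → ℂ) (z : ℂ) : ℂ :=
  if hc : ∃ c : ℝ, SeparatesPoles m n a b c then meijerGLineIntegral m n a b z hc.choose else 0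

/-! ### The two-way network with reciprocal Rayleigh channels -/

/-- The circularly symmetric complex Gaussian law `CN(0, σ²)`: real and imaginary part are
independent, each real Gaussian with mean `0` and variance `σ² / 2`. -/
def complexGaussian (σ : ℝ) : Measure ℂ :=
  ((gaussianReal 0 (σ ^ 2 / 2).toNNReal).prod (gaussianReal 0 (σ ^ 2 / 2).toNNReal)).map
    Complex.measurableEquivRealProd.symm

/-- The fading coefficients `h_ℓ` (first user and element `ℓ`) and `g_ℓ` (second user and
element `ℓ`), `ℓ = 1, …, L`, are `2 L` i.i.d. random variables with law `CN(0, σ²)`. -/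
structure IsRayleighFading {Ω : Type*} [MeasurableSpace Ω] (μ : Measure Ω) {L : ℕ} (σ : ℝ)
    (h g : Fin L → Ω → ℂ) : Prop where
  law_h : ∀ l, HasLaw (h l) (complexGaussian σ) μ
  law_g : ∀ l, HasLaw (g l) (complexGaussian σ) μ
  indep : iIndepFun (Sum.elim h g) μ

/-- The instantaneous SINR `ρ |∑_ℓ g_ℓ e^{i φ_ℓ} h_ℓ|²` of a user when the reflecting elements
induce the phases `φ_ℓ`; here `ρ` is the average SINR. -/
def instSINR {L : ℕ} (ρ : ℝ) (h g : Fin L → ℂ) (φ : Fin L → ℝ) : ℝ :=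
  ρ * ‖∑ l, g l * Complex.exp (Complex.I * (φ l : ℂ)) * h l‖ ^ 2

/-- The optimal phases, which cancel the channel phases: with `h_ℓ = α_ℓ e^{-i φ_ℓ}` and
`g_ℓ = β_ℓ e^{-i ψ_ℓ}` they are `φ_ℓ + ψ_ℓ`. -/
def optPhase {L : ℕ} (h g : Fin L → ℂ) : Fin L → ℝ :=
  fun l => -(h l).arg + -(g l).arg

/-- The random SINR `γ` of a user under the optimal phases. -/
def optSINR {Ω : Type*} {L : ℕ} (ρ : ℝ) (h g : Fin L → Ω → ℂ) (ω : Ω) : ℝ :=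
  instSINR ρ (fun l => h l ω) (fun l => g l ω) (optPhase (fun l => h l ω) (fun l => g l ω))

/-- The average spectral efficiency `E[log₂(1 + γ)]`. -/
def avgSpectralEfficiency {Ω : Type*} [MeasurableSpace Ω] (μ : Measure Ω) {L : ℕ} (ρ : ℝ)
    (h g : Fin L → Ω → ℂ) : ℝ :=
  ∫ ω, Real.logb 2 (1 + optSINR ρ h g ω) ∂μ

end

/-! ### The Bessel integral -/

/-! The phase factor has modulus one, so the SINR is `ρ X Y` with `X = |h|²`, `Y = |g|²`, and polar
coordinates show that `X` and `Y` are independent exponentials of rate `r = 1/σ²`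
(`map_norm_sq_complexGaussian`).

Conditioning on `X` gives `P(XY > s) = r ∫ exp(-rx - rs/x) dx`, which `integral_exp_neg_sub_div`
identifies as a Bessel function. The layer cake formula for `log (1 + γ) = ∫₀^γ du/(1+u)` then gives
the integral for the average spectral efficiency.

The Meijer form does not pass through the Bessel function. Mellin inversion of `1/(1+u)`, integrated
in `u`, writes `log (1 + x)` as a Mellin-Barnes integral of `Γ(w) Γ(1-w) x^w / w` over any line `Re
w = c`, `0 < c < 1`. Taking expectations inside replaces `x^w` by `E[(ρXY)^w] = ρ^w (r^(-w)
Γ(1+w))²`, and `s = -1/2 - w` turns the result into the Meijer integrand. As every such `c` yields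
the same expectation, independence of the line needs no contour shift. -/

theorem integral_Ioi_eq_integral_exp {E : Type*} [NormedAddCommGroup E] [NormedSpace ℝ E]
    {a : ℝ} (ha : 0 < a) (f : ℝ → E) :
    ∫ x in Set.Ioi (0 : ℝ), f x = ∫ u : ℝ, (a * Real.exp u) • f (a * Real.exp u) := by
  have himg : (fun u : ℝ => a * Real.exp u) '' Set.univ = Set.Ioi 0 := by
    ext x
    simp only [Set.image_univ, Set.mem_range, Set.mem_Ioi]
    refine ⟨?_, fun hx => ⟨Real.log (x / a), ?_⟩⟩
    · rintro ⟨u, rfl⟩; positivity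
    · rw [Real.exp_log (by positivity)]; field_simp
  have h := integral_image_eq_integral_abs_deriv_smul (s := Set.univ)
    (f := fun u : ℝ => a * Real.exp u) (f' := fun u => a * Real.exp u) MeasurableSet.univ
    (fun u _ => ((Real.hasDerivAt_exp u).const_mul a).hasDerivWithinAt)
    (fun u _ v _ huv => Real.exp_injective (mul_left_cancel₀ ha.ne' huv)) f
  rw [himg, setIntegral_univ] at h
  rw [h]
  refine integral_congr_ae (.of_forall fun u => ?_)
  simp only
  rw [abs_of_pos (by positivity)]

theorem integrableOn_Ioi_iff_integrable_exp {E : Type*} [NormedAddCommGroup E] [NormedSpace ℝ E]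
    {a : ℝ} (ha : 0 < a) (f : ℝ → E) :
    IntegrableOn f (Set.Ioi (0 : ℝ)) ↔
      Integrable fun u : ℝ => (a * Real.exp u) • f (a * Real.exp u) := by
  have himg : (fun u : ℝ => a * Real.exp u) '' Set.univ = Set.Ioi 0 := by
    ext x
    simp only [Set.image_univ, Set.mem_range, Set.mem_Ioi]
    refine ⟨?_, fun hx => ⟨Real.log (x / a), ?_⟩⟩
    · rintro ⟨u, rfl⟩; positivity
    · rw [Real.exp_log (by positivity)]; field_simp
  have h := integrableOn_image_iff_integrableOn_abs_deriv_smul (s := Set.univ)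
    (f := fun u : ℝ => a * Real.exp u) (f' := fun u => a * Real.exp u) MeasurableSet.univ
    (fun u _ => ((Real.hasDerivAt_exp u).const_mul a).hasDerivWithinAt)
    (fun u _ v _ huv => Real.exp_injective (mul_left_cancel₀ ha.ne' huv)) f
  rw [himg, integrableOn_univ] at h
  rw [h]
  refine integrable_congr (.of_forall fun u => ?_)
  simp only
  rw [abs_of_pos (by positivity)]

theorem integrableOn_exp_neg_sub_div {r s : ℝ} (hr : 0 < r) (hs : 0 ≤ s) :
    IntegrableOn (fun x : ℝ => Real.exp (-(r * x) - r * s / x)) (Set.Ioi 0) := by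
  have h : IntegrableOn (fun x : ℝ => Real.exp (-r * x)) (Set.Ioi 0) := exp_neg_integrableOn_Ioi 0 hr
  refine h.mono' (by fun_prop) ?_
  refine (ae_restrict_iff' measurableSet_Ioi).2 (.of_forall fun x hx => ?_)
  rw [Real.norm_eq_abs, Real.abs_exp, Real.exp_le_exp]
  have hx : 0 < x := hx
  have : 0 ≤ r * s / x := by positivity
  linarith

/-- Under `x = √s e^u` the terms `rx` and `rs/x` become `r√s e^(±u)`, so the exponent is the even
function `-2r√s cosh u`. Symmetrising in `u` replaces the Jacobian factor `e^u` by `cosh u`, the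
weight of `K_1`; folding the line onto the half-line gives the factor 2. -/
theorem integral_exp_neg_sub_div {r s : ℝ} (hr : 0 < r) (hs : 0 < s) :
    ∫ x in Set.Ioi (0 : ℝ), Real.exp (-(r * x) - r * s / x) =
      2 * √s * besselK 1 (2 * r * √s) := by
  set a := √s with ha_def
  have ha : 0 < a := Real.sqrt_pos.2 hs
  have hsa : s = a * a := (Real.mul_self_sqrt hs.le).symm
  set φ : ℝ → ℝ := fun u => Real.exp (-(2 * r * a) * Real.cosh u) with hφ
  have key : ∀ u : ℝ, (a * Real.exp u) • Real.exp (-(r * (a * Real.exp u)) - r * s / (a * Real.exp u))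
      = a * (Real.exp u * φ u) := by
    intro u
    rw [smul_eq_mul, mul_assoc, hφ]
    congr 3
    rw [Real.cosh_eq, Real.exp_neg, hsa]
    field_simp
    ring
  have hint := (integrableOn_Ioi_iff_integrable_exp ha _).1 (integrableOn_exp_neg_sub_div hr hs.le)
  simp_rw [key] at hint
  have hint1 : Integrable fun u : ℝ => Real.exp u * φ u := by
    refine (hint.const_mul a⁻¹).congr (.of_forall fun u => ?_)
    simp only
    field_simp
  have hφe : ∀ u, φ (-u) = φ u := fun u => by simp [hφ]
  have hint2 : Integrable fun u : ℝ => Real.exp (-u) * φ u := by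
    simpa only [hφe] using hint1.comp_neg
  have heq : ∫ u, Real.exp (-u) * φ u = ∫ u, Real.exp u * φ u := by
    simpa only [hφe] using integral_neg_eq_self (fun u : ℝ => Real.exp u * φ u) volume
  have hcosh : ∫ u, Real.cosh u * φ u = ∫ u, Real.exp u * φ u := by
    have : ∀ u, Real.cosh u * φ u = (Real.exp u * φ u + Real.exp (-u) * φ u) / 2 := fun u => by
      rw [Real.cosh_eq]; ring
    simp_rw [this]
    rw [integral_div, integral_add hint1 hint2, heq]
    ring
  have habs : ∫ u, Real.cosh u * φ u = 2 * ∫ u in Set.Ioi (0 : ℝ), Real.cosh u * φ u := by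
    rw [← integral_comp_abs (f := fun u => Real.cosh u * φ u)]
    simp [hφ]
  rw [integral_Ioi_eq_integral_exp ha]
  simp_rw [key]
  rw [integral_const_mul, ← hcosh, habs, besselK]
  simp_rw [one_mul, hφ, mul_comm (Real.cosh _)]
  ring

/-! ### The exponential law -/

/-- The two densities can differ only at the null point `0`; the open half-line is the domain used
by Mellin transforms and the Gamma integral. -/
theorem expMeasure_eq_withDensity_restrict (r : ℝ) :
    expMeasure r = (volume.restrict (Set.Ioi 0)).withDensity
      fun x => ENNReal.ofReal (r * Real.exp (-(r * x))) := by
  rw [← withDensity_indicator measurableSet_Ioi]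
  refine withDensity_congr_ae ?_
  filter_upwards [Measure.ae_ne volume (0 : ℝ)] with x hx
  change exponentialPDF r x = _
  rcases lt_or_gt_of_ne hx with h | h
  · rw [exponentialPDF_of_neg h, Set.indicator_of_notMem (by simpa using h.le)]
  · rw [exponentialPDF_of_nonneg h.le, Set.indicator_of_mem (by simpa using h)]

theorem ae_pos_expMeasure (r : ℝ) : ∀ᵐ x ∂expMeasure r, 0 < x := by
  rw [expMeasure_eq_withDensity_restrict]
  exact (withDensity_absolutelyContinuous _ _).ae_le (ae_restrict_mem measurableSet_Ioi)

theorem integral_expMeasure {E : Type*} [NormedAddCommGroup E] [NormedSpace ℝ E] {r : ℝ}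
    (hr : 0 < r) (f : ℝ → E) :
    ∫ x, f x ∂expMeasure r = ∫ x in Set.Ioi (0 : ℝ), (r * Real.exp (-(r * x))) • f x := by
  rw [expMeasure_eq_withDensity_restrict, integral_withDensity_eq_integral_toReal_smul
    (by fun_prop) (.of_forall fun x => ENNReal.ofReal_lt_top)]
  refine integral_congr_ae (.of_forall fun x => ?_)
  simp only
  rw [ENNReal.toReal_ofReal (by positivity)]

theorem expMeasure_Ioi {r : ℝ} (hr : 0 < r) {t : ℝ} (ht : 0 ≤ t) :
    expMeasure r (Set.Ioi t) = ENNReal.ofReal (Real.exp (-(r * t))) := by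
  have := isProbabilityMeasure_expMeasure hr
  have h := cdf_expMeasure_eq hr t
  rw [if_pos ht, cdf_eq_real] at h
  rw [← Set.compl_Iic, ← ENNReal.ofReal_toReal (measure_ne_top _ _)]
  congr 1
  change (expMeasure r).real (Set.Iic t)ᶜ = _
  rw [probReal_compl_eq_one_sub measurableSet_Iic, h]
  ring

theorem lintegral_Ioi_eq_lintegral_sq (f : ℝ → ENNReal) :
    ∫⁻ x in Set.Ioi (0 : ℝ), f x =
      ∫⁻ x in Set.Ioi (0 : ℝ), ENNReal.ofReal (2 * x) * f (x ^ 2) := by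
  have himg : (fun u : ℝ => u ^ 2) '' Set.Ioi 0 = Set.Ioi 0 := by
    ext x
    simp only [Set.mem_image, Set.mem_Ioi]
    refine ⟨?_, fun hx => ⟨√x, Real.sqrt_pos.2 hx, Real.sq_sqrt hx.le⟩⟩
    rintro ⟨u, hu, rfl⟩; positivity
  have h := lintegral_image_eq_lintegral_abs_deriv_mul (s := Set.Ioi (0 : ℝ))
    (f := fun u : ℝ => u ^ 2) (f' := fun u => 2 * u) measurableSet_Ioi
    (fun u _ => by simpa using (hasDerivAt_pow 2 u).hasDerivWithinAt)
    (fun u hu v hv huv => (pow_left_inj₀ (le_of_lt hu) (le_of_lt hv) two_ne_zero).1 huv) f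
  rw [himg] at h
  rw [h]
  refine setLIntegral_congr_fun measurableSet_Ioi fun x hx => ?_
  have hx : 0 < x := hx
  rw [abs_of_pos (by positivity)]

theorem complexGaussian_eq_withDensity {σ : ℝ} (hσ : 0 < σ) :
    complexGaussian σ = (volume : Measure ℂ).withDensity
      fun z => ENNReal.ofReal ((Real.pi * σ ^ 2)⁻¹ * Real.exp (-(1 / σ ^ 2 * ‖z‖ ^ 2))) := by
  have hv : (σ ^ 2 / 2).toNNReal ≠ 0 := by
    rw [Ne, Real.toNNReal_eq_zero, not_le]; positivity
  have hv' : ((σ ^ 2 / 2).toNNReal : ℝ) = σ ^ 2 / 2 := Real.coe_toNNReal _ (by positivity)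
  have hmp := Complex.volume_preserving_equiv_real_prod.symm
  rw [complexGaussian, gaussianReal_of_var_ne_zero _ hv,
    prod_withDensity (by fun_prop) (by fun_prop)]
  ext s hs
  rw [Measure.map_apply (MeasurableEquiv.measurable _) hs,
    withDensity_apply _ (MeasurableEquiv.measurable _ hs), withDensity_apply _ hs,
    ← hmp.setLIntegral_comp_preimage_emb (MeasurableEquiv.measurableEmbedding _)]
  refine lintegral_congr fun p => ?_
  rw [gaussianPDF, gaussianPDF, ← ENNReal.ofReal_mul (gaussianPDFReal_nonneg _ _ _)]
  congr 1
  rw [gaussianPDFReal, gaussianPDFReal, hv', ← Complex.normSq_eq_norm_sq, Complex.normSq_apply]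
  have h1 : √(2 * Real.pi * (σ ^ 2 / 2)) * √(2 * Real.pi * (σ ^ 2 / 2)) = Real.pi * σ ^ 2 := by
    rw [Real.mul_self_sqrt (by positivity)]; ring
  rw [mul_mul_mul_comm, ← mul_inv, h1, ← Real.exp_add]
  congr 2
  simp only [Complex.measurableEquivRealProd_symm_apply]
  field_simp
  ring

/-- The density depends on `‖z‖` only. In polar coordinates the angle contributes `2π`, leaving the
radial density `(2x/σ²) exp(-x²/σ²)`, and the factor `2x` is the Jacobian of squaring. -/
theorem map_norm_sq_complexGaussian {σ : ℝ} (hσ : 0 < σ) :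
    (complexGaussian σ).map (fun z => ‖z‖ ^ 2) = expMeasure (1 / σ ^ 2) := by
  refine Measure.ext_of_lintegral _ fun F hF => ?_
  rw [lintegral_map hF (by fun_prop), complexGaussian_eq_withDensity hσ,
    lintegral_withDensity_eq_lintegral_mul _ (by fun_prop) (by fun_prop),
    expMeasure_eq_withDensity_restrict,
    lintegral_withDensity_eq_lintegral_mul _ (by fun_prop) (by fun_prop),
    ← Complex.lintegral_comp_polarCoord_symm, lintegral_Ioi_eq_lintegral_sq,
    polarCoord_target, Measure.volume_eq_prod, ← Measure.prod_restrict]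
  simp only [Pi.mul_apply, Complex.norm_polarCoord_symm, sq_abs, smul_eq_mul]
  rw [lintegral_prod _ (by fun_prop)]
  refine setLIntegral_congr_fun measurableSet_Ioi fun x hx => ?_
  have hx : 0 < x := hx
  simp only [lintegral_const, Measure.restrict_apply MeasurableSet.univ, Set.univ_inter,
    Real.volume_Ioo]
  have key : ENNReal.ofReal x * ENNReal.ofReal ((Real.pi * σ ^ 2)⁻¹ *
        Real.exp (-(1 / σ ^ 2 * x ^ 2))) * ENNReal.ofReal (Real.pi - -Real.pi) =
      ENNReal.ofReal (2 * x) * ENNReal.ofReal (1 / σ ^ 2 * Real.exp (-(1 / σ ^ 2 * x ^ 2))) := by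
    rw [← ENNReal.ofReal_mul (by positivity), ← ENNReal.ofReal_mul (by positivity),
      ← ENNReal.ofReal_mul (by positivity)]
    congr 1
    have := Real.pi_pos
    field_simp
    ring
  rw [← mul_assoc (ENNReal.ofReal (2 * x)), ← key]
  ring

/-! ### A Mellin-Barnes representation of the logarithm -/

theorem integral_exp_neg_one_add_mul {x : ℝ} (hx : 0 < x) :
    ∫ t in Set.Ioi (0 : ℝ), Real.exp (-(1 + x) * t) = (1 + x)⁻¹ := by
  rw [integral_exp_mul_Ioi (by linarith)]
  rw [mul_zero, Real.exp_zero, neg_div_neg_eq, one_div]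

theorem mellinConvergent_inv_one_add {s : ℂ} (h0 : 0 < s.re) (h1 : s.re < 1) :
    MellinConvergent (fun x : ℝ => (((1 + x)⁻¹ : ℝ) : ℂ)) s := by
  refine mellinConvergent_of_isBigO_rpow (a := 1) (b := 0) ?_ ?_ h1 ?_ h0
  · refine ContinuousOn.locallyIntegrableOn (fun x hx => ?_) measurableSet_Ioi
    have hx : 0 < x := hx
    refine ContinuousAt.continuousWithinAt ?_
    have : 1 + x ≠ 0 := by positivity
    fun_prop (disch := assumption)
  · refine Asymptotics.IsBigO.of_bound 1 ?_
    filter_upwards [Filter.eventually_gt_atTop 0] with x hx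
    rw [Complex.norm_real, Real.norm_of_nonneg (by positivity), Real.rpow_neg_one, one_mul,
      Real.norm_of_nonneg (by positivity)]
    gcongr
    linarith
  · refine Asymptotics.IsBigO.of_bound 1 ?_
    filter_upwards [self_mem_nhdsWithin] with x hx
    have hx : 0 < x := hx
    rw [Complex.norm_real, Real.norm_of_nonneg (by positivity)]
    simp only [neg_zero, Real.rpow_zero, norm_one, mul_one]
    exact inv_le_one_of_one_le₀ (by linarith)

/-- Insert `1/(1+x) = ∫ exp(-(1+x)t) dt` and swap: the `x`-integral gives `Γ(s) t^(-s)`, and the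
remaining `t`-integral is `Γ(1-s)`. -/
theorem mellin_inv_one_add {s : ℂ} (h0 : 0 < s.re) (h1 : s.re < 1) :
    mellin (fun x : ℝ => (((1 + x)⁻¹ : ℝ) : ℂ)) s = Complex.Gamma s * Complex.Gamma (1 - s) := by
  have hconv := mellinConvergent_inv_one_add h0 h1
  set F : ℝ → ℝ → ℂ := fun x t => (x : ℂ) ^ (s - 1) * (Real.exp (-(1 + x) * t) : ℂ) with hF
  have hinner : ∀ x ∈ Set.Ioi (0 : ℝ),
      (x : ℂ) ^ (s - 1) • (((1 + x)⁻¹ : ℝ) : ℂ) = ∫ t in Set.Ioi (0 : ℝ), F x t := fun x hx => by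
    rw [hF, integral_const_mul, integral_complex_ofReal, integral_exp_neg_one_add_mul hx, smul_eq_mul]
  have hprod : Integrable (Function.uncurry F)
      ((volume.restrict (Set.Ioi 0)).prod (volume.restrict (Set.Ioi 0))) := by
    rw [integrable_prod_iff (by
      refine Measurable.aestronglyMeasurable ?_
      simp only [hF, Function.uncurry_def]
      fun_prop)]
    refine ⟨(ae_restrict_iff' measurableSet_Ioi).2 (.of_forall fun x hx => ?_), ?_⟩
    · have hx : 0 < x := hx
      have hexp : IntegrableOn (fun t : ℝ => Real.exp (-(1 + x) * t)) (Set.Ioi 0) :=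
        integrableOn_exp_mul_Ioi (by linarith) 0
      exact (hexp.ofReal (𝕜 := ℂ)).const_mul ((x : ℂ) ^ (s - 1))
    · refine hconv.norm.congr ((ae_restrict_iff' measurableSet_Ioi).2 (.of_forall fun x hx => ?_))
      have hx' : 0 < x := hx
      simp only [hF, Function.uncurry_def, norm_mul, norm_smul, Complex.norm_real, Real.norm_eq_abs,
        Real.abs_exp]
      rw [integral_const_mul, integral_exp_neg_one_add_mul hx', abs_of_pos (by positivity)]
  rw [mellin, setIntegral_congr_fun measurableSet_Ioi hinner, integral_integral_swap hprod,
    Complex.Gamma_eq_integral (s := 1 - s) (by simpa using h1), Complex.GammaIntegral,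
    ← integral_const_mul]
  refine setIntegral_congr_fun measurableSet_Ioi fun t ht => ?_
  have ht : 0 < t := ht
  have hsplit : ∀ x : ℝ, F x t =
      (Real.exp (-t) : ℂ) * ((x : ℂ) ^ (s - 1) * Complex.exp (-((t : ℂ) * x))) := fun x => by
    simp only [hF]
    rw [show -(1 + x) * t = -t + -(t * x) by ring, Real.exp_add]
    push_cast
    ring
  simp_rw [hsplit]
  rw [integral_const_mul, Complex.integral_cpow_mul_exp_neg_mul_Ioi h0 (by simpa using ht),
    one_div, Complex.inv_cpow _ _ (by rw [Complex.arg_ofReal_of_nonneg ht.le]; exact Real.pi_pos.ne),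
    ← Complex.cpow_neg, show (1 : ℂ) - s - 1 = -s by ring]
  ring

theorem one_add_sq_div_four_le_cosh (t : ℝ) : (1 + t ^ 2) / 4 ≤ Real.cosh t := by
  rw [← Real.cosh_abs, Real.cosh_eq]
  have h1 := Real.quadratic_le_exp_of_nonneg (abs_nonneg t)
  have h2 := Real.add_one_le_exp (-|t|)
  rw [sq_abs] at h1
  -- The linear terms in `|t|` cancel when the two exponential bounds are added.
  nlinarith [sq_nonneg t]

theorem sin_mul_cosh_le_norm_sin (x y : ℝ) :
    Real.sin x * Real.cosh y ≤ ‖Complex.sin (x + y * Complex.I)‖ := by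
  refine le_trans (le_of_eq ?_) (Complex.re_le_norm _)
  rw [Complex.sin_add_mul_I]
  simp [← Complex.ofReal_sin, ← Complex.ofReal_cosh,
    ← Complex.ofReal_cos, ← Complex.ofReal_sinh]

/-- By reflection the product is `π / sin(πw)`. On the line, `|sin(πw)| ≥ sin(πc) cosh(πt)` with
`sin(πc) > 0`, and a quadratic lower bound for `cosh` already suffices for integrability. -/
theorem integrable_Gamma_mul_Gamma_one_sub {c : ℝ} (h0 : 0 < c) (h1 : c < 1) :
    Integrable fun t : ℝ => Complex.Gamma (c + t * Complex.I) *
      Complex.Gamma (1 - (c + t * Complex.I)) := by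
  simp_rw [Complex.Gamma_mul_Gamma_one_sub]
  have hs : 0 < Real.sin (Real.pi * c) :=
    Real.sin_pos_of_pos_of_lt_pi (by positivity) (by nlinarith [Real.pi_pos])
  refine (integrable_inv_one_add_sq.const_mul (Real.pi * 4 / Real.sin (Real.pi * c))).mono'
    (Measurable.aestronglyMeasurable (by fun_prop)) (.of_forall fun t => ?_)
  have h := sin_mul_cosh_le_norm_sin (Real.pi * c) (Real.pi * t)
  have hcosh : (1 + t ^ 2) / 4 ≤ Real.cosh (Real.pi * t) := by
    refine (one_add_sq_div_four_le_cosh t).trans (Real.cosh_le_cosh.2 ?_)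
    rw [abs_mul, abs_of_pos Real.pi_pos]
    nlinarith [Real.pi_gt_three, abs_nonneg t]
  have h' : Real.sin (Real.pi * c) * ((1 + t ^ 2) / 4) ≤
      ‖Complex.sin (Real.pi * (c + t * Complex.I))‖ := by
    refine (mul_le_mul_of_nonneg_left hcosh hs.le).trans (h.trans (le_of_eq ?_))
    push_cast
    ring_nf
  rw [norm_div, Complex.norm_real, Real.norm_of_nonneg Real.pi_pos.le]
  calc Real.pi / _ ≤ Real.pi / (Real.sin (Real.pi * c) * ((1 + t ^ 2) / 4)) := by gcongr
    _ = _ := by field_simp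

theorem inv_one_add_eq_integral_Gamma {c u : ℝ} (h0 : 0 < c) (h1 : c < 1) (hu : 0 < u) :
    (((1 + u)⁻¹ : ℝ) : ℂ) = (1 / (2 * (Real.pi : ℂ))) * ∫ t : ℝ,
      Complex.Gamma (c + t * Complex.I) * Complex.Gamma (1 - (c + t * Complex.I)) *
        (u : ℂ) ^ ((c : ℂ) + t * Complex.I - 1) := by
  have hmel : ∀ y : ℝ, mellin (fun x : ℝ => (((1 + x)⁻¹ : ℝ) : ℂ)) (((1 - c : ℝ) : ℂ) + y * Complex.I)
      = Complex.Gamma (((1 - c : ℝ) : ℂ) + y * Complex.I) *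
        Complex.Gamma (1 - (((1 - c : ℝ) : ℂ) + y * Complex.I)) := fun y =>
    mellin_inv_one_add (by simpa using h1) (by simpa using h0)
  have hu' : 1 + u ≠ 0 := by positivity
  -- Inverting on `Re s = 1 - c` and setting `w = 1 - s` turns `u^(-s)` into `u^(w-1)`, while `Γ(s)
  -- Γ(1-s)` is symmetric. The reversed orientation is absorbed by `t ↦ -t`.
  have h := mellinInv_mellin_eq (1 - c) (fun x : ℝ => (((1 + x)⁻¹ : ℝ) : ℂ)) hu
    (mellinConvergent_inv_one_add (by simpa using h1) (by simpa using h0))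
    (by
      rw [Complex.VerticalIntegrable]
      simp_rw [hmel]
      exact integrable_Gamma_mul_Gamma_one_sub (by linarith) (by linarith))
    (by fun_prop (disch := assumption))
  rw [← h, mellinInv, ← integral_neg_eq_self (fun t : ℝ => _ * (u : ℂ) ^ ((c : ℂ) + t * Complex.I - 1))]
  simp_rw [hmel, smul_eq_mul, Complex.real_smul]
  push_cast
  congr 2
  ext t
  have h1 : (c : ℂ) + -t * Complex.I = 1 - (1 - c + t * Complex.I) := by ring
  have h2 : 1 - (1 - (1 - (c : ℂ) + t * Complex.I)) = 1 - c + t * Complex.I := by ring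
  have h3 : 1 - (1 - (c : ℂ) + t * Complex.I) - 1 = -(1 - c + t * Complex.I) := by ring
  rw [h1, h2, h3]
  ring

theorem integral_inv_one_add {x : ℝ} (hx : 0 ≤ x) :
    ∫ u in (0 : ℝ)..x, (1 + u)⁻¹ = Real.log (1 + x) := by
  rw [intervalIntegral.integral_comp_add_left (fun u : ℝ => u⁻¹), add_zero,
    integral_inv_of_pos one_pos (by linarith), div_one]

/-- Integrate the representation of `1/(1+u)` over `(0, x]`: since `Re w = c > 0`, `u^(w-1)`
integrates to `x^w / w`, and `u^(c-1) |G t|` is an integrable majorant for Fubini. -/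
theorem log_one_add_eq_integral_Gamma {c x : ℝ} (h0 : 0 < c) (h1 : c < 1) (hx : 0 ≤ x) :
    (Real.log (1 + x) : ℂ) = (1 / (2 * (Real.pi : ℂ))) * ∫ t : ℝ,
      Complex.Gamma (c + t * Complex.I) * Complex.Gamma (1 - (c + t * Complex.I)) /
        (c + t * Complex.I) * (x : ℂ) ^ ((c : ℂ) + t * Complex.I) := by
  have hG := integrable_Gamma_mul_Gamma_one_sub h0 h1
  set G : ℝ → ℂ := fun t => Complex.Gamma (c + t * Complex.I) *
    Complex.Gamma (1 - (c + t * Complex.I)) with hGdef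
  have hpow : IntegrableOn (fun u : ℝ => u ^ (c - 1)) (Set.Ioc 0 x) :=
    (intervalIntegrable_iff_integrableOn_Ioc_of_le hx).1
      (intervalIntegral.intervalIntegrable_rpow' (by linarith))
  have hprod : Integrable
      (Function.uncurry fun (u t : ℝ) => G t * (u : ℂ) ^ ((c : ℂ) + t * Complex.I - 1))
      ((volume.restrict (Set.Ioc 0 x)).prod volume) := by
    refine (hpow.mul_prod hG.norm).mono' ?_ ?_
    · simp only [Function.uncurry_def]
      refine (hG.aestronglyMeasurable.comp_snd).mul (Measurable.aestronglyMeasurable ?_)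
      fun_prop
    · have : ∀ᵐ p : ℝ × ℝ ∂(volume.restrict (Set.Ioc 0 x)).prod volume, p.1 ∈ Set.Ioc 0 x :=
        Measure.quasiMeasurePreserving_fst.ae (ae_restrict_mem measurableSet_Ioc)
      filter_upwards [this] with p hp
      simp only [Function.uncurry_def, norm_mul]
      rw [Complex.norm_cpow_eq_rpow_re_of_pos hp.1, mul_comm]
      simp
  have hlog : (Real.log (1 + x) : ℂ) = ∫ u in Set.Ioc 0 x, (((1 + u)⁻¹ : ℝ) : ℂ) := by
    rw [integral_complex_ofReal, ← intervalIntegral.integral_of_le hx, integral_inv_one_add hx]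
  rw [hlog, setIntegral_congr_fun measurableSet_Ioc fun u hu =>
    inv_one_add_eq_integral_Gamma h0 h1 hu.1, integral_const_mul, integral_integral_swap hprod]
  congr 1
  refine integral_congr_ae (.of_forall fun t => ?_)
  simp only
  have hw : (c : ℂ) + t * Complex.I ≠ 0 := fun h => h0.ne' (by simpa using congrArg Complex.re h)
  rw [integral_const_mul, ← intervalIntegral.integral_of_le hx,
    integral_cpow (Or.inl (by simpa using h0)), sub_add_cancel, Complex.ofReal_zero,
    Complex.zero_cpow hw, sub_zero]
  simp only [hGdef]
  ring

/-! ### Moments of the exponential law -/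

theorem integrable_expMeasure_iff {E : Type*} [NormedAddCommGroup E] [NormedSpace ℝ E] {r : ℝ}
    (hr : 0 < r) {f : ℝ → E} :
    Integrable f (expMeasure r) ↔
      IntegrableOn (fun x => (r * Real.exp (-(r * x))) • f x) (Set.Ioi 0) := by
  rw [expMeasure_eq_withDensity_restrict, integrable_withDensity_iff_integrable_smul'
    (by fun_prop) (.of_forall fun x => ENNReal.ofReal_lt_top), IntegrableOn]
  refine integrable_congr (.of_forall fun x => ?_)
  simp only
  rw [ENNReal.toReal_ofReal (by positivity)]

theorem integrable_rpow_expMeasure {r c : ℝ} (hr : 0 < r) (hc : -1 < c) :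
    Integrable (fun x : ℝ => x ^ c) (expMeasure r) := by
  rw [integrable_expMeasure_iff hr]
  refine ((integrableOn_rpow_mul_exp_neg_mul_rpow hc one_pos hr).const_mul r).congr
    (.of_forall fun x => ?_)
  simp only [Real.rpow_one, smul_eq_mul, neg_mul]
  ring

theorem integral_cpow_expMeasure {r : ℝ} {w : ℂ} (hr : 0 < r) (hw : -1 < w.re) :
    ∫ x, (x : ℂ) ^ w ∂expMeasure r = ((1 / r : ℝ) : ℂ) ^ w * Complex.Gamma (1 + w) := by
  have h := Complex.integral_cpow_mul_exp_neg_mul_Ioi (a := 1 + w) (r := r)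
    (by simp; linarith) (by simpa using hr)
  have hr' : (r : ℂ) ≠ 0 := by exact_mod_cast hr.ne'
  have heq : ∀ x : ℝ, (r * Real.exp (-(r * x))) • (x : ℂ) ^ w =
      r * ((x : ℂ) ^ (1 + w - 1) * Complex.exp (-(r * x))) := fun x => by
    rw [Complex.real_smul, add_sub_cancel_left]
    push_cast
    ring
  rw [integral_expMeasure hr]
  simp_rw [heq]
  rw [integral_const_mul, h, Complex.cpow_add _ _ (by simpa using hr'), Complex.cpow_one]
  push_cast
  field_simp

/-! ### The layer cake formula for the logarithm -/

theorem integral_log_one_add_eq_integral_measureReal {Ω : Type*} [MeasurableSpace Ω]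
    {μ : Measure Ω} [IsFiniteMeasure μ] {γ : Ω → ℝ} (hpos : 0 ≤ᵐ[μ] γ) (hγ : Integrable γ μ) :
    Integrable (fun ω => Real.log (1 + γ ω)) μ ∧
    IntegrableOn (fun x : ℝ => μ.real {ω | x < γ ω} / (1 + x)) (Set.Ioi 0) ∧
    ∫ ω, Real.log (1 + γ ω) ∂μ = ∫ x in Set.Ioi (0 : ℝ), μ.real {ω | x < γ ω} / (1 + x) := by
  have hlogpos : 0 ≤ᵐ[μ] fun ω => Real.log (1 + γ ω) := by
    filter_upwards [hpos] with ω h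
    exact Real.log_nonneg (by simpa using h)
  have hmeas : AEStronglyMeasurable (fun ω => Real.log (1 + γ ω)) μ :=
    (Real.measurable_log.comp_aemeasurable (hγ.aemeasurable.const_add 1)).aestronglyMeasurable
  have hint : Integrable (fun ω => Real.log (1 + γ ω)) μ := by
    refine hγ.mono' hmeas ?_
    filter_upwards [hpos, hlogpos] with ω h h'
    rw [Real.norm_of_nonneg h']
    have h : 0 ≤ γ ω := h
    linarith [Real.log_le_sub_one_of_pos (show 0 < 1 + γ ω by linarith)]
  have hcake := lintegral_comp_eq_lintegral_meas_lt_mul (g := fun t => (1 + t)⁻¹) μ hpos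
    hγ.aemeasurable (fun t ht => by
      refine ContinuousOn.intervalIntegrable fun x hx => ContinuousAt.continuousWithinAt ?_
      rw [Set.uIcc_of_le ht.le] at hx
      have : 1 + x ≠ 0 := by linarith [hx.1]
      fun_prop (disch := assumption))
    ((ae_restrict_iff' measurableSet_Ioi).2 (.of_forall fun x hx => by
      have hx : 0 < x := hx
      exact inv_nonneg.2 (by linarith)))
  have hleft : ∫⁻ ω, ENNReal.ofReal (∫ t in (0 : ℝ)..γ ω, (1 + t)⁻¹) ∂μ =
      ∫⁻ ω, ENNReal.ofReal (Real.log (1 + γ ω)) ∂μ := by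
    refine lintegral_congr_ae ?_
    filter_upwards [hpos] with ω h
    rw [integral_inv_one_add h]
  rw [hleft] at hcake
  -- Monotonicity supplies the measurability of the tail function.
  have hanti : Antitone fun x : ℝ => μ {ω | x < γ ω} := fun x y hxy =>
    measure_mono fun ω (h : y < γ ω) => lt_of_le_of_lt hxy h
  have hM : Measurable fun x : ℝ => μ {ω | x < γ ω} * ENNReal.ofReal (1 + x)⁻¹ :=
    hanti.measurable.mul (by fun_prop)
  have hfin : ∫⁻ x in Set.Ioi (0 : ℝ), μ {ω | x < γ ω} * ENNReal.ofReal (1 + x)⁻¹ ≠ ⊤ := by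
    rw [← hcake]
    exact hint.lintegral_lt_top.ne
  have htoReal : ∀ x ∈ Set.Ioi (0 : ℝ),
      (μ {ω | x < γ ω} * ENNReal.ofReal (1 + x)⁻¹).toReal = μ.real {ω | x < γ ω} / (1 + x) := by
    intro x hx
    have hx : 0 < x := hx
    rw [ENNReal.toReal_mul, ENNReal.toReal_ofReal (by positivity), div_eq_mul_inv]
    rfl
  refine ⟨hint, ?_, ?_⟩
  · exact (integrable_toReal_of_lintegral_ne_top hM.aemeasurable hfin).congr
      ((ae_restrict_iff' measurableSet_Ioi).2 (.of_forall htoReal))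
  · rw [integral_eq_lintegral_of_nonneg_ae hlogpos hmeas, hcake,
      ← setIntegral_congr_fun measurableSet_Ioi htoReal, integral_toReal hM.aemeasurable
      (ae_lt_top hM hfin)]

/-! ### Scaled product of two independent exponential random variables -/

theorem ae_pos_of_hasLaw_expMeasure {Ω : Type*} [MeasurableSpace Ω] {μ : Measure Ω} {r : ℝ}
    {X : Ω → ℝ} (hX : HasLaw X (expMeasure r) μ) : ∀ᵐ ω ∂μ, 0 < X ω := by
  have h := ae_pos_expMeasure r
  rw [← hX.map_eq] at h
  exact ae_of_ae_map hX.aemeasurable h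

theorem measureReal_lt_mul_mul_of_expMeasure {Ω : Type*} [MeasurableSpace Ω] {μ : Measure Ω}
    [IsProbabilityMeasure μ] {r ρ : ℝ} (hr : 0 < r) (hρ : 0 < ρ) {X Y : Ω → ℝ}
    (hX : HasLaw X (expMeasure r) μ) (hY : HasLaw Y (expMeasure r) μ) (hXY : IndepFun X Y μ)
    {t : ℝ} (ht : 0 < t) :
    μ.real {ω | t < ρ * (X ω * Y ω)} = 2 * r * √(t / ρ) * besselK 1 (2 * r * √(t / ρ)) := by
  have hE := isProbabilityMeasure_expMeasure hr
  have hs : 0 < t / ρ := by positivity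
  have hmeas : MeasurableSet {p : ℝ × ℝ | t < ρ * (p.1 * p.2)} :=
    measurableSet_lt (by fun_prop) (by fun_prop)
  have h := (IndepFun.hasLaw_prod hX hY hXY).measureReal_eq (p := fun p => t < ρ * (p.1 * p.2)) hmeas
  have hexp : ∀ x : ℝ, 0 < x →
      expMeasure r (Prod.mk x ⁻¹' {p : ℝ × ℝ | t < ρ * (p.1 * p.2)}) =
        ENNReal.ofReal (Real.exp (-(r * (t / ρ) / x))) := by
    intro x hx
    -- For fixed `X = x > 0` the event is a tail event for `Y`, of probability `exp(-r(t/ρ)/x)`.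
    have : Prod.mk x ⁻¹' {p : ℝ × ℝ | t < ρ * (p.1 * p.2)} = Set.Ioi (t / ρ / x) := by
      ext y
      simp only [Set.mem_preimage, Set.mem_ofPred_eq, Set.mem_Ioi]
      rw [div_lt_iff₀ hx, div_lt_iff₀ hρ]
      ring_nf
    rw [this, expMeasure_Ioi hr (by positivity), mul_div_assoc]
  rw [h, measureReal_def, Measure.prod_apply hmeas,
    lintegral_congr_ae ((ae_pos_expMeasure r).mono hexp), ← integral_eq_lintegral_of_nonneg_ae
    (.of_forall fun x => (Real.exp_pos _).le)
    (Measurable.aestronglyMeasurable (by fun_prop)), integral_expMeasure hr]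
  have hsplit : ∀ x : ℝ, (r * Real.exp (-(r * x))) • Real.exp (-(r * (t / ρ) / x)) =
      r * Real.exp (-(r * x) - r * (t / ρ) / x) := fun x => by
    rw [sub_eq_add_neg, Real.exp_add, smul_eq_mul, mul_assoc]
  simp_rw [hsplit]
  rw [integral_const_mul, integral_exp_neg_sub_div hr hs]
  ring

/-- Used twice: real exponents `c` in `(0, 1)` dominate the complex powers in Fubini, and `c = 1`
makes the SINR itself integrable. -/
theorem integrable_mul_mul_rpow_of_expMeasure {Ω : Type*} [MeasurableSpace Ω] {μ : Measure Ω}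
    {r ρ c : ℝ} (hr : 0 < r) (hρ : 0 < ρ) (hc : -1 < c) {X Y : Ω → ℝ}
    (hX : HasLaw X (expMeasure r) μ) (hY : HasLaw Y (expMeasure r) μ) (hXY : IndepFun X Y μ) :
    Integrable (fun ω => (ρ * (X ω * Y ω)) ^ c) μ := by
  have hp : ∀ {Z : Ω → ℝ}, HasLaw Z (expMeasure r) μ → Integrable (fun ω => Z ω ^ c) μ :=
    fun {Z} hZ => by
      have h := integrable_rpow_expMeasure hr hc
      rw [← hZ.map_eq] at h
      exact h.comp_aemeasurable hZ.aemeasurable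
  have hind : IndepFun (fun ω => X ω ^ c) (fun ω => Y ω ^ c) μ :=
    hXY.comp (φ := fun x : ℝ => x ^ c) (ψ := fun x : ℝ => x ^ c) (by fun_prop) (by fun_prop)
  refine ((hind.integrable_mul (hp hX) (hp hY)).const_mul (ρ ^ c)).congr ?_
  filter_upwards [ae_pos_of_hasLaw_expMeasure hX, ae_pos_of_hasLaw_expMeasure hY] with ω h1 h2
  rw [Real.mul_rpow hρ.le (by positivity), Real.mul_rpow h1.le h2.le]
  rfl

theorem integral_mul_mul_cpow_of_expMeasure {Ω : Type*} [MeasurableSpace Ω] {μ : Measure Ω}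
    {r ρ : ℝ} {w : ℂ} (hr : 0 < r) (hρ : 0 < ρ) (hw : -1 < w.re) {X Y : Ω → ℝ}
    (hX : HasLaw X (expMeasure r) μ) (hY : HasLaw Y (expMeasure r) μ) (hXY : IndepFun X Y μ) :
    ∫ ω, ((ρ * (X ω * Y ω) : ℝ) : ℂ) ^ w ∂μ =
      (ρ : ℂ) ^ w * (((1 / r : ℝ) : ℂ) ^ w * Complex.Gamma (1 + w)) ^ 2 := by
  have hsplit : ∀ᵐ ω ∂μ, ((ρ * (X ω * Y ω) : ℝ) : ℂ) ^ w =
      (ρ : ℂ) ^ w * ((X ω : ℂ) ^ w * (Y ω : ℂ) ^ w) := by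
    filter_upwards [ae_pos_of_hasLaw_expMeasure hX, ae_pos_of_hasLaw_expMeasure hY] with ω h1 h2
    rw [Complex.ofReal_mul, Complex.mul_cpow_ofReal_nonneg hρ.le (by positivity),
      Complex.ofReal_mul, Complex.mul_cpow_ofReal_nonneg h1.le h2.le]
  have hm : Measurable fun x : ℝ => (x : ℂ) ^ w := by fun_prop
  have hmom : ∀ {Z : Ω → ℝ}, HasLaw Z (expMeasure r) μ →
      ∫ ω, (Z ω : ℂ) ^ w ∂μ = ((1 / r : ℝ) : ℂ) ^ w * Complex.Gamma (1 + w) := fun {Z} hZ => by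
    rw [← integral_cpow_expMeasure hr hw, ← hZ.integral_comp hm.aestronglyMeasurable]
    rfl
  rw [integral_congr_ae hsplit, integral_const_mul,
    hXY.integral_fun_comp_mul_comp (f := fun x : ℝ => (x : ℂ) ^ w) (g := fun x : ℝ => (x : ℂ) ^ w)
      hX.aemeasurable hY.aemeasurable hm.aestronglyMeasurable hm.aestronglyMeasurable,
    hmom hX, hmom hY, sq]

/-- The Mellin-Barnes kernel of the expected value of `log (1 + ρ X Y)` for independent exponential
random variables `X`, `Y` of rate `r`. -/
noncomputable def expProductKernel (r ρ : ℝ) (w : ℂ) : ℂ :=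
  Complex.Gamma w * Complex.Gamma (1 - w) / w *
    ((ρ : ℂ) ^ w * (((1 / r : ℝ) : ℂ) ^ w * Complex.Gamma (1 + w)) ^ 2)

theorem integral_log_one_add_eq_mellinBarnes {Ω : Type*} [MeasurableSpace Ω] {μ : Measure Ω}
    [IsProbabilityMeasure μ] {r ρ c : ℝ} (hr : 0 < r) (hρ : 0 < ρ) (h0 : 0 < c) (h1 : c < 1)
    {X Y : Ω → ℝ} (hX : HasLaw X (expMeasure r) μ) (hY : HasLaw Y (expMeasure r) μ)
    (hXY : IndepFun X Y μ) :
    Integrable (fun t : ℝ => expProductKernel r ρ (c + t * Complex.I)) ∧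
    ((∫ ω, Real.log (1 + ρ * (X ω * Y ω)) ∂μ : ℝ) : ℂ) =
      (1 / (2 * (Real.pi : ℂ))) * ∫ t : ℝ, expProductKernel r ρ (c + t * Complex.I) := by
  have hG := integrable_Gamma_mul_Gamma_one_sub h0 h1
  set G : ℝ → ℂ := fun t => Complex.Gamma (c + t * Complex.I) *
    Complex.Gamma (1 - (c + t * Complex.I)) with hGdef
  have hpos : ∀ᵐ ω ∂μ, 0 < ρ * (X ω * Y ω) := by
    filter_upwards [ae_pos_of_hasLaw_expMeasure hX, ae_pos_of_hasLaw_expMeasure hY] with ω h1 h2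
    positivity
  have hm : AEMeasurable (fun ω => ρ * (X ω * Y ω)) μ :=
    (hX.aemeasurable.mul hY.aemeasurable).const_mul ρ
  set F : Ω → ℝ → ℂ := fun ω t => G t / (c + t * Complex.I) *
    ((ρ * (X ω * Y ω) : ℝ) : ℂ) ^ ((c : ℂ) + t * Complex.I) with hF
  have hprod : Integrable (Function.uncurry F) (μ.prod volume) := by
    refine ((integrable_mul_mul_rpow_of_expMeasure hr hρ (by linarith : -1 < c) hX hY hXY).mul_prod
      (hG.norm.div_const c)).mono' ?_ ?_
    · simp only [hF, Function.uncurry_def]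
      refine AEStronglyMeasurable.mul ?_ (AEMeasurable.aestronglyMeasurable ?_)
      · refine AEStronglyMeasurable.comp_snd (f := fun t : ℝ => G t / (c + t * Complex.I)) ?_
        exact (hG.aemeasurable.div (by fun_prop)).aestronglyMeasurable
      · exact (Complex.measurable_ofReal.comp_aemeasurable hm.comp_fst).pow
          (Measurable.aemeasurable (by fun_prop))
    · have : ∀ᵐ p : Ω × ℝ ∂μ.prod volume, 0 < ρ * (X p.1 * Y p.1) :=
        Measure.quasiMeasurePreserving_fst.ae hpos
      filter_upwards [this] with p hp
      simp only [hF, Function.uncurry_def, norm_mul, norm_div]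
      rw [Complex.norm_cpow_eq_rpow_re_of_pos hp, mul_comm]
      have hre : ((c : ℂ) + p.2 * Complex.I).re = c := by simp
      -- The bound `|w| ≥ Re w = c` controls the factor `1/w` uniformly along the line.
      have hc : c ≤ ‖(c : ℂ) + p.2 * Complex.I‖ := hre.symm.le.trans (Complex.re_le_norm _)
      rw [hre]
      gcongr
  have hinner : ∀ t : ℝ, ∫ ω, F ω t ∂μ = expProductKernel r ρ (c + t * Complex.I) := fun t => by
    rw [hF, integral_const_mul, integral_mul_mul_cpow_of_expMeasure hr hρ
      (by simp; linarith) hX hY hXY]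
    rfl
  refine ⟨?_, ?_⟩
  · have := hprod.integral_prod_right
    simpa only [Function.uncurry_apply_pair, hinner] using this
  · simp_rw [← hinner]
    rw [← integral_integral_swap hprod, ← integral_const_mul, ← integral_complex_ofReal]
    refine integral_congr_ae ?_
    filter_upwards [hpos] with ω h
    exact log_one_add_eq_integral_Gamma h0 h1 h.le

/-! ### The Meijer function as a Mellin-Barnes integral -/

/-- This strip is the image of `0 < Re w < 1` under `s = -1/2 - w`. -/
theorem separatesPoles_iff (c : ℝ) :
    SeparatesPoles 3 1 ![-1 / 2] ![-1 / 2, -1 / 2, 1 / 2] c ↔ c < -1 / 2 ∧ -3 / 2 < c := by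
  have e : ((-1 / 2 : ℂ)).re = -1 / 2 := by norm_num
  simp only [SeparatesPoles, Fin.forall_fin_succ, Fin.forall_fin_zero]
  simp [e]
  constructor
  · rintro ⟨h, h'⟩
    refine ⟨by linarith, by linarith⟩
  · rintro ⟨h, h'⟩
    refine ⟨⟨by linarith, by linarith⟩, by linarith⟩

/-- At `s = -1/2 - w` the Gamma factors are `Γ(w)² Γ(1+w) Γ(1-w)`. In the kernel, one factor `Γ(1+w)
= w Γ(w)` cancels the `1/w`. The constant `√ρ/r` is `(r²/ρ)^(-1/2)`. -/
theorem meijerGIntegrand_eq {r ρ : ℝ} (hr : 0 < r) (hρ : 0 < ρ) {w : ℂ} (hw : w ≠ 0) :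
    meijerGIntegrand 3 1 ![-1 / 2] ![-1 / 2, -1 / 2, 1 / 2] ((r ^ 2 / ρ : ℝ) : ℂ) (-1 / 2 - w) =
      ((√ρ / r : ℝ) : ℂ) * expProductKernel r ρ w := by
  have hz : 0 < r ^ 2 / ρ := by positivity
  have hz' : ((r ^ 2 / ρ : ℝ) : ℂ) ≠ 0 := by exact_mod_cast hz.ne'
  have hpow : ((r ^ 2 / ρ : ℝ) : ℂ) ^ (-1 / 2 - w) =
      ((√ρ / r : ℝ) : ℂ) * ((ρ : ℂ) ^ w * (((1 / r : ℝ) : ℂ) ^ w) ^ 2) := by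
    rw [sub_eq_add_neg, Complex.cpow_add _ _ hz']
    congr 1
    · rw [show (-1 / 2 : ℂ) = ((-(1 / 2) : ℝ) : ℂ) by norm_num, ← Complex.ofReal_cpow hz.le,
        Real.rpow_neg hz.le, ← Real.sqrt_eq_rpow, Real.sqrt_div (by positivity),
        Real.sqrt_sq hr.le, inv_div]
    · rw [Complex.cpow_neg, ← Complex.inv_cpow_ofReal_nonneg hz.le, ← Complex.ofReal_inv,
        show (r ^ 2 / ρ)⁻¹ = ρ * (1 / r * (1 / r)) by field_simp, Complex.ofReal_mul,
        Complex.mul_cpow_ofReal_nonneg hρ.le (by positivity), Complex.ofReal_mul,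
        Complex.mul_cpow_ofReal_nonneg (by positivity) (by positivity), sq]
  have hG : Complex.Gamma (1 + w) = w * Complex.Gamma w := by
    rw [add_comm, Complex.Gamma_add_one w hw]
  have e1 : (-1 / 2 : ℂ) - (-1 / 2 - w) = w := by ring
  have e2 : (2 : ℂ)⁻¹ - (-1 / 2 - w) = 1 + w := by ring
  have e3 : 1 - (-1 / 2 : ℂ) + (-1 / 2 - w) = 1 - w := by ring
  rw [expProductKernel, meijerGIntegrand, hpow, Fin.prod_univ_three, Fin.prod_univ_one]
  simp [e1, e2, e3]
  simp only [hG]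
  field_simp

theorem hasMeijerG_of_expMeasure {Ω : Type*} [MeasurableSpace Ω] {μ : Measure Ω}
    [IsProbabilityMeasure μ] {r ρ : ℝ} (hr : 0 < r) (hρ : 0 < ρ)
    {X Y : Ω → ℝ} (hX : HasLaw X (expMeasure r) μ) (hY : HasLaw Y (expMeasure r) μ)
    (hXY : IndepFun X Y μ) :
    HasMeijerG 3 1 ![-1 / 2] ![-1 / 2, -1 / 2, 1 / 2] ((r ^ 2 / ρ : ℝ) : ℂ)
      ((√ρ / r : ℝ) * (∫ ω, Real.log (1 + ρ * (X ω * Y ω)) ∂μ : ℝ)) := by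
  refine ⟨⟨-1, (separatesPoles_iff _).2 (by norm_num)⟩, fun c hc => ?_⟩
  obtain ⟨hc1, hc2⟩ := (separatesPoles_iff c).1 hc
  -- The line `Re s = c` corresponds to `Re w = -1/2 - c`, traversed downwards; hence the `-t`
  -- below.
  obtain ⟨hint, heq⟩ := integral_log_one_add_eq_mellinBarnes (c := -1 / 2 - c) hr hρ (by linarith)
    (by linarith) hX hY hXY
  have key : ∀ t : ℝ, meijerGIntegrand 3 1 ![-1 / 2] ![-1 / 2, -1 / 2, 1 / 2]
      ((r ^ 2 / ρ : ℝ) : ℂ) ((c : ℂ) + (t : ℂ) * Complex.I) =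
        ((√ρ / r : ℝ) : ℂ) * expProductKernel r ρ (((-1 / 2 - c : ℝ) : ℂ) +
          ((-t : ℝ) : ℂ) * Complex.I) := fun t => by
    have hw : ((-1 / 2 - c : ℝ) : ℂ) + ((-t : ℝ) : ℂ) * Complex.I ≠ 0 := fun h => by
      have := congrArg Complex.re h
      simp only [Complex.add_re, Complex.ofReal_re, Complex.re_ofReal_mul, Complex.I_re, mul_zero,
        Complex.zero_re] at this
      linarith
    have h := meijerGIntegrand_eq hr hρ hw
    rw [← h]
    congr 1
    push_cast
    ring
  refine ⟨?_, ?_⟩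
  · simp_rw [key]
    exact hint.comp_neg.const_mul _
  · rw [meijerGLineIntegral, heq]
    simp_rw [key]
    rw [integral_const_mul, integral_neg_eq_self (fun t : ℝ => expProductKernel r ρ
      (((-1 / 2 - c : ℝ) : ℂ) + t * Complex.I))]
    ring

/-- `meijerG` integrates along an arbitrarily chosen separating line; a common value on all of them
makes the choice irrelevant. -/
theorem HasMeijerG.meijerG_eq {m n p q : ℕ} {a : Fin p → ℂ} {b : Fin q → ℂ} {z w : ℂ}
    (h : HasMeijerG m n a b z w) : meijerG m n a b z = w := by
  rw [meijerG, dif_pos h.1]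
  exact (h.2 _ h.1.choose_spec).2

/-! ### The SINR of the two-way link -/

/-- With a single element there is nothing to align: any real phase gives a factor of modulus one.
-/
theorem optSINR_one {Ω : Type*} (ρ : ℝ) (h g : Fin 1 → Ω → ℂ) :
    optSINR ρ h g = fun ω => ρ * (‖h 0 ω‖ ^ 2 * ‖g 0 ω‖ ^ 2) := by
  ext ω
  simp only [optSINR, instSINR, Fin.sum_univ_one, norm_mul]
  rw [mul_comm Complex.I, Complex.norm_exp_ofReal_mul_I]
  ring

theorem one_sub_cdf_map {Ω : Type*} [MeasurableSpace Ω] {μ : Measure Ω} [IsProbabilityMeasure μ]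
    {γ : Ω → ℝ} (hγ : AEMeasurable γ μ) (t : ℝ) :
    1 - cdf (μ.map γ) t = μ.real {ω | t < γ ω} := by
  have := Measure.isProbabilityMeasure_map hγ
  rw [cdf_eq_real, ← probReal_compl_eq_one_sub measurableSet_Iic, Set.compl_Iic,
    map_measureReal_apply_of_aemeasurable hγ measurableSet_Ioi]
  rfl

theorem hasLaw_norm_sq {Ω : Type*} [MeasurableSpace Ω] {μ : Measure Ω} {σ : ℝ} (hσ : 0 < σ)
    {Z : Ω → ℂ} (hZ : HasLaw Z (complexGaussian σ) μ) :
    HasLaw (fun ω => ‖Z ω‖ ^ 2) (expMeasure (1 / σ ^ 2)) μ :=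
  HasLaw.fun_comp ⟨by fun_prop, map_norm_sq_complexGaussian hσ⟩ hZ

theorem mainTheorem4 {Ω : Type*} [MeasurableSpace Ω] (μ : Measure Ω) [IsProbabilityMeasure μ]
    (σ ρ : ℝ) (hσ : 0 < σ) (hρ : 0 < ρ) (h g : Fin 1 → Ω → ℂ) (hfad : IsRayleighFading μ σ h g) :
    (∀ t : ℝ, 0 < t →
      1 - cdf (μ.map (optSINR ρ h g)) t =
        2 / σ ^ 2 * √(t / ρ) * besselK 1 (2 / σ ^ 2 * √(t / ρ))) ∧
    Integrable (fun ω => Real.logb 2 (1 + optSINR ρ h g ω)) μ ∧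
    IntegrableOn (fun x : ℝ => (1 - cdf (μ.map (optSINR ρ h g)) x) / (1 + x)) (Set.Ioi 0) ∧
    avgSpectralEfficiency μ ρ h g =
      1 / Real.log 2 * ∫ x in Set.Ioi (0 : ℝ), (1 - cdf (μ.map (optSINR ρ h g)) x) / (1 + x) ∧
    IntegrableOn (fun x : ℝ => √x / (1 + x) * besselK 1 (2 / σ ^ 2 * √(x / ρ))) (Set.Ioi 0) ∧
    avgSpectralEfficiency μ ρ h g =
      1 / Real.log 2 * (2 / (σ ^ 2 * √ρ)) *
        ∫ x in Set.Ioi (0 : ℝ), √x / (1 + x) * besselK 1 (2 / σ ^ 2 * √(x / ρ)) ∧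
    HasMeijerG 3 1 ![-1 / 2] ![-1 / 2, -1 / 2, 1 / 2] ((1 / (σ ^ 4 * ρ) : ℝ) : ℂ)
      (meijerG 3 1 ![-1 / 2] ![-1 / 2, -1 / 2, 1 / 2] ((1 / (σ ^ 4 * ρ) : ℝ) : ℂ)) ∧
    ((avgSpectralEfficiency μ ρ h g : ℝ) : ℂ) =
      ((1 / (Real.log 2 * σ ^ 2 * √ρ) : ℝ) : ℂ) *
        meijerG 3 1 ![-1 / 2] ![-1 / 2, -1 / 2, 1 / 2] ((1 / (σ ^ 4 * ρ) : ℝ) : ℂ) := by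
  have hr : 0 < 1 / σ ^ 2 := by positivity
  have hX := hasLaw_norm_sq hσ (hfad.law_h 0)
  have hY := hasLaw_norm_sq hσ (hfad.law_g 0)
  have hXY : IndepFun (fun ω => ‖h 0 ω‖ ^ 2) (fun ω => ‖g 0 ω‖ ^ 2) μ :=
    (hfad.indep.indepFun (i := Sum.inl 0) (j := Sum.inr 0) (by simp)).comp
      (φ := fun z : ℂ => ‖z‖ ^ 2) (ψ := fun z : ℂ => ‖z‖ ^ 2) (by fun_prop) (by fun_prop)
  have hm : AEMeasurable (optSINR ρ h g) μ := by
    rw [optSINR_one]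
    exact (hX.aemeasurable.mul hY.aemeasurable).const_mul ρ
  have hpos : 0 ≤ᵐ[μ] optSINR ρ h g := .of_forall fun ω => by
    rw [optSINR_one]
    simp only [Pi.zero_apply]
    positivity
  have hint : Integrable (optSINR ρ h g) μ := by
    simpa [optSINR_one] using
      integrable_mul_mul_rpow_of_expMeasure (c := 1) hr hρ (by norm_num) hX hY hXY
  obtain ⟨hlog, hcdf, heq⟩ := integral_log_one_add_eq_integral_measureReal hpos hint
  have hR : avgSpectralEfficiency μ ρ h g =
      1 / Real.log 2 * ∫ ω, Real.log (1 + optSINR ρ h g ω) ∂μ := by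
    rw [avgSpectralEfficiency]
    simp_rw [Real.logb]
    rw [integral_div]
    ring
  have hsurv : ∀ t : ℝ, 0 < t → μ.real {ω | t < optSINR ρ h g ω} =
      2 / σ ^ 2 * √(t / ρ) * besselK 1 (2 / σ ^ 2 * √(t / ρ)) := fun t ht => by
    rw [optSINR_one, measureReal_lt_mul_mul_of_expMeasure hr hρ hX hY hXY ht, mul_one_div]
  have hρ' : 0 < √ρ := Real.sqrt_pos.2 hρ
  have hbessel : ∀ x ∈ Set.Ioi (0 : ℝ), μ.real {ω | x < optSINR ρ h g ω} / (1 + x) =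
      2 / (σ ^ 2 * √ρ) * (√x / (1 + x) * besselK 1 (2 / σ ^ 2 * √(x / ρ))) := fun x hx => by
    have hx : 0 < x := hx
    rw [hsurv x hx]
    nth_rw 1 [Real.sqrt_div hx.le]
    field_simp
  have hz : 1 / (σ ^ 4 * ρ) = (1 / σ ^ 2) ^ 2 / ρ := by field_simp
  have hM := hasMeijerG_of_expMeasure hr hρ hX hY hXY
  rw [← hz] at hM
  simp_rw [one_sub_cdf_map hm]
  refine ⟨hsurv, ?_, hcdf, by rw [hR, heq], ?_, ?_, by rwa [hM.meijerG_eq], ?_⟩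
  · simp_rw [Real.logb]
    exact hlog.div_const _
  -- Integrability of the Bessel integrand is inherited from the tail integral, of which it is a
  -- constant multiple on the half-line.
  · refine IntegrableOn.congr_fun (Integrable.const_mul hcdf (2 / (σ ^ 2 * √ρ))⁻¹)
      (fun x hx => ?_) measurableSet_Ioi
    rw [hbessel x hx]
    field_simp
  · rw [hR, heq, setIntegral_congr_fun measurableSet_Ioi hbessel, integral_const_mul, mul_assoc]
  · rw [hM.meijerG_eq, hR, optSINR_one]
    -- The factor `√ρ / (1/σ²)` is the `√ρ/r` that multiplies the expectation in the Meijer value.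
    have hc : 1 / (Real.log 2 * σ ^ 2 * √ρ) * (√ρ / (1 / σ ^ 2)) = 1 / Real.log 2 := by
      have := Real.log_pos one_lt_two
      field_simp
    rw [← mul_assoc, ← Complex.ofReal_mul, ← Complex.ofReal_mul, hc]
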